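/- Let $E$ be a uniformly smooth and uniformly convex real Banach space with dual $E^*$, let $p>1$, and let $J:E\to E^*$ be the generalized duality map, $Jx=\{f\in E^*: f(x)=\|x\|^p,\ \|f\|=\|x\|^{p-1}\}$. Let $A:E\to E^*$ map bounded sets to bounded sets, be $\eta$-strongly monotone, i.e. $\eta>0$ and $\langle x-y,Ax-Ay\rangle\ge\eta\|x-y\|^p$ for all $x,y\in E$, and satisfy the range condition, i.e. $A$ is monotone and $J+tA$ maps $E$ onto $E^*$ for every $t>0$. Let $x^*\in E$ with $Ax^*=0$, and let $x_1\in E$ be arbitrary. Then $J$ is a single-valued bijection of $E$ onto $E^*$, $x^*$ is the only solution of $Ax=0$, and there is an $r_0>0$ (independent of the sequences below) such that the following holds for every $r\ge r_0$. Put $$B=r^{1/p}+\|x^*\|,\quad M_0=\sup\{\|Ax+\theta(Jx-Jx_1)\|:\theta\in(0,1),\ \|x\|\le B\}+1,\quad \varepsilon_0=\min\Big\{1,\frac{\eta r}{4M_0}\Big\},$$ and let $\psi(t)=\sup\{\|J^{-1}f-J^{-1}g\|:\ \|f\|,\|g\|\le B^{p-1}+M_0,\ \|f-g\|\le t\}$,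 $t\ge 0$, be the modulus of continuity of $J^{-1}$ on the closed ball of $E^*$ with centre $0$ and radius $B^{p-1}+M_0$. Let $(\lambda_n)_{n\ge1}$ and $(\theta_n)_{n\ge1}$ be sequences in $(0,1)$ such that (i) $(\theta_n)$ is decreasing (not necessarily strictly) and $\theta_n\to0$; (ii) $\sum_{n\ge1}\lambda_n\theta_n=\infty$; (iii) $\dfrac{(\theta_{n-1}/\theta_n)-1}{\lambda_n\theta_n}\to0$ and $\sum_{n\ge1}\lambda_n^2<\infty$. If $\psi(\lambda_nM_0)\le\varepsilon_0$ for all $n\ge1$, then the sequence defined by $$x_{n+1}=J^{-1}\big(Jx_n-\lambda_n(Ax_n+\theta_n(Jx_n-Jx_1))\big),\qquad n\ge1,$$ converges strongly to $x^*$. -/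

import Mathlib

open Filter Topology Set

noncomputable section

/-- A real normed space is uniformly smooth if the limit of `(‖x + t y‖ - ‖x‖) / t` as `t → 0`,
`t ≠ 0`, exists for all `x, y` in the unit sphere and is attained uniformly in `x` and `y`. -/
def IsUniformlySmooth (E : Type*) [NormedAddCommGroup E] [NormedSpace ℝ E] : Prop :=
  ∃ D : E × E → ℝ,
    TendstoUniformlyOn (fun (t : ℝ) (q : E × E) => (‖q.1 + t • q.2‖ - ‖q.1‖) / t) D (𝓝[≠] 0)
      (Metric.sphere (0 : E) 1 ×ˢ Metric.sphere (0 : E) 1)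

section

variable {E : Type*} [NormedAddCommGroup E] [NormedSpace ℝ E]

/-- The set-valued generalized duality mapping `J_p : E → 2^{E*}`. -/
def dualitySet (p : ℝ) (x : E) : Set (StrongDual ℝ E) :=
  {f | f x = ‖x‖ ^ p ∧ ‖f‖ = ‖x‖ ^ (p - 1)}

/-- The generalized duality mapping as a function `J : E → E*`: a selection of `dualitySet p`,
which is the only one when `dualitySet p` is single-valued. -/
def dualityMap (p : ℝ) (x : E) : StrongDual ℝ E :=
  Classical.epsilon (fun f => f ∈ dualitySet p x)

/-- The inverse `J⁻¹ : E* → E` of the generalized duality mapping. -/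
def dualityInv (p : ℝ) : StrongDual ℝ E → E :=
  Function.invFun (dualityMap (E := E) p)

/-- `A` is bounded: it maps bounded sets to bounded sets. -/
def IsBoundedMap (A : E → StrongDual ℝ E) : Prop :=
  ∀ S : Set E, Bornology.IsBounded S → Bornology.IsBounded (A '' S)

/-- `A` is monotone. -/
def IsMonotoneMap (A : E → StrongDual ℝ E) : Prop :=
  ∀ x y : E, 0 ≤ (A x - A y) (x - y)

/-- `A` is `η`-strongly monotone (with exponent `p`). -/
def IsStronglyMonotone (p η : ℝ) (A : E → StrongDual ℝ E) : Prop :=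
  0 < η ∧ ∀ x y : E, η * ‖x - y‖ ^ p ≤ (A x - A y) (x - y)

/-- `A` satisfies the range condition: it is monotone and `J + t A` is onto `E*` for all `t > 0`. -/
def RangeCondition (p : ℝ) (A : E → StrongDual ℝ E) : Prop :=
  IsMonotoneMap A ∧
    ∀ t : ℝ, 0 < t → Function.Surjective (fun x : E => dualityMap p x + t • A x)

/-- The modulus of continuity of `J⁻¹` on the closed ball of radius `ρ` about `0` in `E*`:
`ψ(t) = sup {‖J⁻¹ f - J⁻¹ g‖ : ‖f‖ ≤ ρ, ‖g‖ ≤ ρ, ‖f - g‖ ≤ t}`. -/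
def dualityInvModulus (E : Type*) [NormedAddCommGroup E] [NormedSpace ℝ E] (p ρ t : ℝ) : ℝ :=
  sSup {s : ℝ | ∃ f g : StrongDual ℝ E, ‖f‖ ≤ ρ ∧ ‖g‖ ≤ ρ ∧ ‖f - g‖ ≤ t ∧
    s = ‖dualityInv p f - dualityInv p g‖}

/-- The constant
`M₀ = sup {‖A x + θ (J x - J x₁)‖ : θ ∈ (0,1), ‖x‖ ≤ B} + 1`. -/
def stepBound (p : ℝ) (A : E → StrongDual ℝ E) (x₁ : E) (B : ℝ) : ℝ :=
  sSup {s : ℝ | ∃ (θ : ℝ) (x : E), 0 < θ ∧ θ < 1 ∧ ‖x‖ ≤ B ∧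
    s = ‖A x + θ • (dualityMap p x - dualityMap p x₁)‖} + 1

/-- The conditions on the real sequences `(λ_n)` and `(θ_n)`, `n ≥ 1`. -/
structure AdmissibleSteps (lam θ : ℕ → ℝ) : Prop where
  lam_mem : ∀ n, 1 ≤ n → lam n ∈ Ioo (0 : ℝ) 1
  theta_mem : ∀ n, 1 ≤ n → θ n ∈ Ioo (0 : ℝ) 1
  theta_anti : AntitoneOn θ (Ici 1)
  theta_lim : Tendsto θ atTop (𝓝 0)
  sum_lam_theta : Tendsto (fun N => ∑ n ∈ Finset.Icc 1 N, lam n * θ n) atTop atTop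
  ratio_lim :
    Tendsto (fun n => (θ n / θ (n + 1) - 1) / (lam (n + 1) * θ (n + 1))) atTop (𝓝 0)
  sum_lam_sq : Summable (fun n => lam (n + 1) ^ 2)

/-- `(x_n)`, `n ≥ 1`, starts at `x₁` and satisfies
`x_{n+1} = J⁻¹ (J x_n - λ_n (A x_n + θ_n (J x_n - J x₁)))`. -/
def IsIteration (p : ℝ) (A : E → StrongDual ℝ E) (lam θ : ℕ → ℝ) (x₁ : E) (x : ℕ → E) : Prop :=
  x 1 = x₁ ∧ ∀ n, 1 ≤ n → x (n + 1) =
    dualityInv p (dualityMap p (x n) -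
      lam n • (A (x n) + θ n • (dualityMap p (x n) - dualityMap p x₁)))

end

end

noncomputable section

section

variable {E : Type*} [NormedAddCommGroup E] [NormedSpace ℝ E]

theorem mul_rpow_sub_one_le {p a b : ℝ} (hp : 1 < p) (ha : 0 ≤ a) (hb : 0 ≤ b) :
    p * (a ^ (p - 1) * b) ≤ b ^ p + (p - 1) * a ^ p := by
  have hp0 : 0 < p := by linarith
  have hp1 : 0 < p - 1 := by linarith
  have h := Real.young_inequality_of_nonneg hb (Real.rpow_nonneg ha (p - 1))
    (Real.HolderConjugate.conjExponent hp)
  have e : (a ^ (p - 1)) ^ (Real.conjExponent p) = a ^ p := by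
    rw [← Real.rpow_mul ha, Real.conjExponent]
    congr 1
    field_simp
  rw [e, Real.conjExponent] at h
  calc p * (a ^ (p - 1) * b) = p * (b * a ^ (p - 1)) := by ring
    _ ≤ p * (b ^ p / p + a ^ p / (p / (p - 1))) := by gcongr
    _ = b ^ p + (p - 1) * a ^ p := by field_simp

theorem rpow_sub_one_mul_self {p a : ℝ} (hp : 1 < p) (ha : 0 ≤ a) : a ^ (p - 1) * a = a ^ p := by
  rcases ha.eq_or_lt with rfl | h
  · rw [mul_zero, Real.zero_rpow (by linarith)]
  · rw [Real.rpow_sub_one h.ne', div_mul_cancel₀ _ h.ne']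

theorem apply_eq_of_tendsto_norm_slope {u y : E} {f : StrongDual ℝ E} {d : ℝ} (hu : ‖u‖ = 1)
    (hf : ‖f‖ ≤ 1) (hfu : f u = 1)
    (hd : Tendsto (fun t : ℝ => (‖u + t • y‖ - ‖u‖) / t) (𝓝[≠] 0) (𝓝 d)) : f y = d := by
  have key : ∀ t : ℝ, t * f y ≤ ‖u + t • y‖ - ‖u‖ := by
    intro t
    have h1 : f (u + t • y) ≤ ‖u + t • y‖ := by
      refine (le_abs_self _).trans ((f.le_opNorm _).trans ?_)
      simpa using mul_le_mul_of_nonneg_right hf (norm_nonneg (u + t • y))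
    rw [map_add, map_smul, smul_eq_mul, hfu] at h1
    rw [hu]; linarith
  apply le_antisymm
  · have h := hd.mono_left (nhdsWithin_mono (0 : ℝ)
      (show Ioi (0 : ℝ) ⊆ {0}ᶜ from fun t (ht : 0 < t) => ht.ne'))
    refine ge_of_tendsto h ?_
    filter_upwards [self_mem_nhdsWithin] with t ht
    rw [le_div_iff₀ ht, mul_comm]
    exact key t
  · have h := hd.mono_left (nhdsWithin_mono (0 : ℝ)
      (show Iio (0 : ℝ) ⊆ {0}ᶜ from fun t (ht : t < 0) => ht.ne))
    refine le_of_tendsto h ?_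
    filter_upwards [self_mem_nhdsWithin] with t ht
    rw [div_le_iff_of_neg ht, mul_comm]
    exact key t

theorem IsUniformlySmooth.eq_of_norming (hE : IsUniformlySmooth E) {u : E} {f g : StrongDual ℝ E}
    (hu : ‖u‖ = 1) (hf : ‖f‖ ≤ 1) (hfu : f u = 1) (hg : ‖g‖ ≤ 1) (hgu : g u = 1) : f = g := by
  obtain ⟨D, hD⟩ := hE
  have key : ∀ y : E, ‖y‖ = 1 → f y = g y := by
    intro y hy
    have h := hD.tendsto_at (x := (u, y)) ⟨by simpa using hu, by simpa using hy⟩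
    rw [apply_eq_of_tendsto_norm_slope hu hf hfu h, apply_eq_of_tendsto_norm_slope hu hg hgu h]
  ext y
  rcases eq_or_ne y 0 with rfl | hy
  · simp
  · have h := key (‖y‖⁻¹ • y) (by rw [norm_smul, norm_inv, norm_norm, inv_mul_cancel₀ (by simpa)])
    rw [map_smul, map_smul] at h
    exact smul_right_injective ℝ (inv_ne_zero (norm_ne_zero_iff.2 hy)) h

theorem dualitySet_nonempty {p : ℝ} (hp : 1 < p) (x : E) : (dualitySet p x).Nonempty := by
  rcases eq_or_ne x 0 with rfl | hx
  · refine ⟨0, ?_, ?_⟩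
    · simp [Real.zero_rpow (show p ≠ 0 by linarith)]
    · simp [Real.zero_rpow (show p - 1 ≠ 0 by linarith)]
  · obtain ⟨g, hg, hgx⟩ := exists_dual_vector ℝ x (by simpa using hx)
    refine ⟨‖x‖ ^ (p - 1) • g, ?_, ?_⟩
    · simp only [_root_.smul_apply, smul_eq_mul, hgx]
      exact rpow_sub_one_mul_self hp (norm_nonneg x)
    · rw [norm_smul, hg, mul_one, Real.norm_of_nonneg (by positivity)]

theorem IsUniformlySmooth.dualitySet_subsingleton (hE : IsUniformlySmooth E) {p : ℝ} (hp : 1 < p)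
    (x : E) : (dualitySet p x).Subsingleton := by
  rintro f ⟨hf, hf'⟩ g ⟨hg, hg'⟩
  rcases eq_or_ne x 0 with rfl | hx
  · rw [norm_zero, Real.zero_rpow (by linarith), norm_eq_zero] at hf' hg'
    rw [hf', hg']
  · have hx0 : 0 < ‖x‖ := norm_pos_iff.2 hx
    set c := ‖x‖ ^ (p - 1) with hc
    have hc0 : 0 < c := by positivity
    have aux : ∀ h : StrongDual ℝ E, h x = ‖x‖ ^ p → ‖h‖ = c →
        ‖c⁻¹ • h‖ ≤ 1 ∧ (c⁻¹ • h) (‖x‖⁻¹ • x) = 1 := by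
      intro h h1 h2
      constructor
      · rw [norm_smul, h2, norm_inv, Real.norm_of_nonneg hc0.le, inv_mul_cancel₀ hc0.ne']
      · rw [_root_.smul_apply, map_smul, h1, smul_eq_mul, smul_eq_mul,
          ← rpow_sub_one_mul_self hp hx0.le, ← hc]
        field_simp
    have h := hE.eq_of_norming (u := ‖x‖⁻¹ • x)
      (by rw [norm_smul, norm_inv, norm_norm, inv_mul_cancel₀ hx0.ne'])
      (aux f hf hf').1 (aux f hf hf').2 (aux g hg hg').1 (aux g hg hg').2
    exact smul_right_injective _ (inv_ne_zero hc0.ne') h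

theorem dualityMap_mem {p : ℝ} (hp : 1 < p) (x : E) : dualityMap p x ∈ dualitySet p x :=
  Classical.epsilon_spec (dualitySet_nonempty hp x)

theorem dualityMap_apply_self {p : ℝ} (hp : 1 < p) (x : E) : dualityMap p x x = ‖x‖ ^ p :=
  (dualityMap_mem hp x).1

theorem norm_dualityMap {p : ℝ} (hp : 1 < p) (x : E) : ‖dualityMap p x‖ = ‖x‖ ^ (p - 1) :=
  (dualityMap_mem hp x).2

theorem dualityMap_apply_le {p : ℝ} (hp : 1 < p) (x y : E) :
    dualityMap p x y ≤ ‖x‖ ^ (p - 1) * ‖y‖ := by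
  rw [← norm_dualityMap hp x]
  exact (le_abs_self _).trans ((dualityMap p x).le_opNorm y)

theorem neg_dualityMap_apply_le {p : ℝ} (hp : 1 < p) (x y : E) :
    -dualityMap p x y ≤ ‖x‖ ^ (p - 1) * ‖y‖ := by
  rw [← norm_dualityMap hp x]
  exact (neg_le_abs _).trans ((dualityMap p x).le_opNorm y)

/-- The Lyapunov functional `W(z, x) = ‖z‖ ^ p + (p - 1) ‖x‖ ^ p - p ⟨z, J x⟩`. -/
def lyapunov (p : ℝ) (z x : E) : ℝ := ‖z‖ ^ p + (p - 1) * ‖x‖ ^ p - p * dualityMap p x z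

theorem lyapunov_nonneg {p : ℝ} (hp : 1 < p) (z x : E) : 0 ≤ lyapunov p z x := by
  have h1 := mul_rpow_sub_one_le hp (norm_nonneg x) (norm_nonneg z)
  have h2 := mul_le_mul_of_nonneg_left (dualityMap_apply_le hp x z) (show 0 ≤ p by linarith)
  unfold lyapunov
  linarith

theorem lyapunov_add {p : ℝ} (hp : 1 < p) (z x y : E) :
    lyapunov p z y + lyapunov p y x =
      lyapunov p z x + p * (dualityMap p y - dualityMap p x) (y - z) := by
  have h := dualityMap_apply_self hp y
  simp only [lyapunov, _root_.sub_apply, map_sub, h]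
  ring

theorem lyapunov_self {p : ℝ} (hp : 1 < p) (x : E) : lyapunov p x x = 0 := by
  have h := dualityMap_apply_self hp x
  simp only [lyapunov, h]
  ring

theorem dualityMap_monotone {p : ℝ} (hp : 1 < p) (x y : E) :
    0 ≤ (dualityMap p y - dualityMap p x) (y - x) := by
  have h := lyapunov_add hp x x y
  rw [lyapunov_self hp] at h
  have h1 := lyapunov_nonneg hp x y
  have h2 := lyapunov_nonneg hp y x
  exact nonneg_of_mul_nonneg_right (by linarith) (show 0 < p by linarith)

theorem lyapunov_le {p : ℝ} (hp : 1 < p) (z x : E) :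
    lyapunov p z x ≤ ‖z‖ ^ p - ‖x‖ ^ p + p * (‖x‖ ^ (p - 1) * ‖x - z‖) := by
  have h := dualityMap_apply_self hp x
  have h1 := mul_le_mul_of_nonneg_left (dualityMap_apply_le hp x (x - z)) (show 0 ≤ p by linarith)
  rw [map_sub, h] at h1
  unfold lyapunov
  linarith

theorem lyapunov_midpoint_le {p : ℝ} (hp : 1 < p) (x y : E) :
    ‖x‖ ^ p + ‖y‖ ^ p - 2 * (‖x + y‖ / 2) ^ p ≤ lyapunov p y x := by
  have h := lyapunov_nonneg hp ((1 / 2 : ℝ) • (x + y)) x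
  have hx := dualityMap_apply_self hp x
  have e : ‖(1 / 2 : ℝ) • (x + y)‖ = ‖x + y‖ / 2 := by
    rw [norm_smul, Real.norm_of_nonneg (by norm_num)]; ring
  unfold lyapunov at h ⊢
  rw [e, map_smul, map_add, hx, smul_eq_mul] at h
  linarith

theorem eq_of_rpow_add_rpow_le {p a b c : ℝ} (hp : 1 < p) (ha : 0 ≤ a) (hb : 0 ≤ b) (hc : 0 ≤ c)
    (hcab : c ≤ a + b) (h : a ^ p + b ^ p ≤ 2 * (c / 2) ^ p) : a = b ∧ c = 2 * a := by
  have hab : a = b := by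
    by_contra hne
    have h1 := (strictConvexOn_rpow hp).2 ha hb hne (show (0 : ℝ) < 1 / 2 by norm_num)
      (show (0 : ℝ) < 1 / 2 by norm_num) (by norm_num)
    simp only [smul_eq_mul] at h1
    have h2 : (c / 2) ^ p ≤ (1 / 2 * a + 1 / 2 * b) ^ p :=
      Real.rpow_le_rpow (by linarith) (by linarith) (by linarith)
    linarith
  subst hab
  refine ⟨rfl, le_antisymm (by linarith) ?_⟩
  have h1 : a ^ p ≤ (c / 2) ^ p := by linarith
  have h2 := (Real.rpow_le_rpow_iff ha (by linarith) (by linarith : 0 < p)).1 h1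
  linarith

/-- Uniform convexity of `‖·‖ ^ p` on bounded sets. -/
theorem exists_forall_rpow_gap [UniformConvexSpace E] {p : ℝ} (hp : 1 < p) (R : ℝ) {ε : ℝ}
    (hε : 0 < ε) :
    ∃ δ, 0 < δ ∧ ∀ x y : E, ‖x‖ ≤ R → ‖y‖ ≤ R →
      ‖x‖ ^ p + ‖y‖ ^ p - 2 * (‖x + y‖ / 2) ^ p < δ → ‖x - y‖ < ε := by
  by_contra! H
  choose x y hx hy hgap hxy using fun n : ℕ => H (1 / ((n : ℝ) + 1)) (by positivity)
  have hmem : ∀ n, (‖x n‖, ‖y n‖, ‖x n + y n‖) ∈ Icc 0 R ×ˢ Icc 0 R ×ˢ Icc 0 (R + R) := fun n =>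
    ⟨⟨norm_nonneg _, hx n⟩, ⟨norm_nonneg _, hy n⟩, norm_nonneg _,
      (norm_add_le _ _).trans (add_le_add (hx n) (hy n))⟩
  obtain ⟨⟨a, b, c⟩, ⟨ha, hb, hc⟩, φ, hφ, hlim⟩ :=
    (isCompact_Icc.prod (isCompact_Icc.prod isCompact_Icc)).tendsto_subseq hmem
  dsimp only at ha hb hc
  have la : Tendsto (fun n => ‖x (φ n)‖) atTop (𝓝 a) := (continuous_fst.tendsto _).comp hlim
  have lb : Tendsto (fun n => ‖y (φ n)‖) atTop (𝓝 b) :=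
    ((continuous_fst.comp continuous_snd).tendsto _).comp hlim
  have lc : Tendsto (fun n => ‖x (φ n) + y (φ n)‖) atTop (𝓝 c) :=
    ((continuous_snd.comp continuous_snd).tendsto _).comp hlim
  have hp0 : 0 ≤ p := by linarith
  have hcab : c ≤ a + b := le_of_tendsto_of_tendsto' lc (la.add lb) fun n => norm_add_le _ _
  have hpow : a ^ p + b ^ p - 2 * (c / 2) ^ p ≤ 0 :=
    le_of_tendsto_of_tendsto'
      (((la.rpow_const (.inr hp0)).add (lb.rpow_const (.inr hp0))).sub
        (((lc.div_const 2).rpow_const (.inr hp0)).const_mul 2))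
      (tendsto_one_div_add_atTop_nhds_zero_nat.comp hφ.tendsto_atTop) fun n => (hgap (φ n)).le
  obtain ⟨rfl, rfl⟩ := eq_of_rpow_add_rpow_le hp ha.1 hb.1 hc.1 hcab (by linarith)
  have hεa : ε ≤ a + a :=
    ge_of_tendsto' (la.add lb) fun n => (hxy (φ n)).trans (norm_sub_le _ _)
  have ha0 : 0 < a := by linarith
  have hR : 0 < R := ha0.trans_le ha.2
  obtain ⟨δ, hδ, huc⟩ := exists_forall_closed_ball_dist_add_le_two_sub E (div_pos hε hR)
  set s : ℕ → ℝ := fun n => max ‖x (φ n)‖ ‖y (φ n)‖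
  have ls : Tendsto s atTop (𝓝 a) := by simpa using la.max lb
  have hle : a * 2 ≤ a * (2 - δ) := by
    refine le_of_tendsto_of_tendsto (by simpa [mul_comm] using lc) (ls.mul_const (2 - δ)) ?_
    filter_upwards [ls.eventually (lt_mem_nhds ha0)] with n hn
    have hs : ∀ v : E, ‖(s n)⁻¹ • v‖ = ‖v‖ / s n := fun v => by
      rw [norm_smul, norm_inv, Real.norm_of_nonneg hn.le, div_eq_inv_mul]
    have h := @huc ((s n)⁻¹ • x (φ n)) (by rw [hs, div_le_one hn]; exact le_max_left _ _)
      ((s n)⁻¹ • y (φ n)) (by rw [hs, div_le_one hn]; exact le_max_right _ _) (by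
        rw [← smul_sub, hs]
        exact div_le_div₀ (norm_nonneg _) (hxy _) hn (max_le (hx _) (hy _)))
    rw [← smul_add, hs, div_le_iff₀ hn] at h
    linarith
  nlinarith

theorem exists_forall_lyapunov_lt [UniformConvexSpace E] {p : ℝ} (hp : 1 < p) (R : ℝ) {ε : ℝ}
    (hε : 0 < ε) :
    ∃ δ, 0 < δ ∧ ∀ x y : E, ‖x‖ ≤ R → ‖y‖ ≤ R → lyapunov p y x < δ → ‖x - y‖ < ε := by
  obtain ⟨δ, hδ, h⟩ := exists_forall_rpow_gap (E := E) hp R hε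
  exact ⟨δ, hδ, fun x y hx hy hl => h x y hx hy ((lyapunov_midpoint_le hp x y).trans_lt hl)⟩

theorem dualityMap_injective [UniformConvexSpace E] {p : ℝ} (hp : 1 < p) :
    Function.Injective (dualityMap (E := E) p) := by
  intro x y hxy
  have h := lyapunov_add hp x x y
  rw [lyapunov_self hp, hxy, sub_self, zero_apply] at h
  have h0 : lyapunov p y x = 0 := by
    linarith [lyapunov_nonneg hp x y, lyapunov_nonneg hp y x]
  by_contra hne
  obtain ⟨δ, hδ, hc⟩ := exists_forall_lyapunov_lt (E := E) hp (max ‖x‖ ‖y‖)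
    (norm_pos_iff.2 (sub_ne_zero.2 hne))
  exact lt_irrefl _ (hc x y (le_max_left _ _) (le_max_right _ _) (by rw [h0]; exact hδ))

/-- On a uniformly convex Banach space, every functional attains its norm. -/
theorem exists_apply_eq_norm [CompleteSpace E] [UniformConvexSpace E] {f : StrongDual ℝ E}
    (hf : f ≠ 0) : ∃ u : E, ‖u‖ ≤ 1 ∧ f u = ‖f‖ := by
  have hf0 : 0 < ‖f‖ := norm_pos_iff.2 hf
  have happrox : ∀ n : ℕ, ∃ u : E, ‖u‖ ≤ 1 ∧ ‖f‖ - 1 / ((n : ℝ) + 1) ≤ f u := by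
    intro n
    obtain ⟨u, hu, hfu⟩ := f.exists_lt_apply_of_lt_opNorm
      (show ‖f‖ - 1 / ((n : ℝ) + 1) < ‖f‖ from sub_lt_self _ (by positivity))
    rcases abs_cases (f u) with h | h
    · exact ⟨u, hu.le, by rw [← h.1]; exact hfu.le⟩
    · exact ⟨-u, by simpa using hu.le, by rw [map_neg, ← h.1]; exact hfu.le⟩
  choose u hu hfu using happrox
  have hle : ∀ v : E, f v ≤ ‖f‖ * ‖v‖ := fun v => (le_abs_self _).trans (f.le_opNorm v)
  have hcauchy : CauchySeq u := by
    rw [Metric.cauchySeq_iff]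
    intro ε hε
    obtain ⟨δ, hδ, huc⟩ := exists_forall_closed_ball_dist_add_le_two_sub E hε
    obtain ⟨N, hN⟩ := exists_nat_one_div_lt (show 0 < ‖f‖ * δ / 2 by positivity)
    refine ⟨N, fun m hm n hn => ?_⟩
    by_contra! hmn
    rw [dist_eq_norm] at hmn
    have h1 := mul_le_mul_of_nonneg_left (huc (hu m) (hu n) hmn) hf0.le
    have h2 := hle (u m + u n)
    rw [map_add] at h2
    have h3 : ∀ k, N ≤ k → 1 / ((k : ℝ) + 1) ≤ 1 / ((N : ℝ) + 1) := fun k hk =>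
      Nat.one_div_le_one_div hk
    linarith [hfu m, hfu n, h3 m hm, h3 n hn]
  obtain ⟨v, hv⟩ := cauchySeq_tendsto_of_complete hcauchy
  have hv1 : ‖v‖ ≤ 1 := le_of_tendsto' hv.norm hu
  refine ⟨v, hv1, le_antisymm ((hle v).trans (mul_le_of_le_one_right hf0.le hv1)) ?_⟩
  have h := le_of_tendsto_of_tendsto' (tendsto_const_nhds.sub
    tendsto_one_div_add_atTop_nhds_zero_nat) ((f.continuous.tendsto v).comp hv) hfu
  simpa using h

theorem dualityMap_surjective [CompleteSpace E] [UniformConvexSpace E] (hE : IsUniformlySmooth E)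
    {p : ℝ} (hp : 1 < p) : Function.Surjective (dualityMap (E := E) p) := by
  intro f
  suffices h : ∃ x : E, f ∈ dualitySet p x by
    obtain ⟨x, hx⟩ := h
    exact ⟨x, hE.dualitySet_subsingleton hp x (dualityMap_mem hp x) hx⟩
  rcases eq_or_ne f 0 with rfl | hf
  · exact ⟨0, by simp [Real.zero_rpow (show p ≠ 0 by linarith)],
      by simp [Real.zero_rpow (show p - 1 ≠ 0 by linarith)]⟩
  · obtain ⟨u, hu, hfu⟩ := exists_apply_eq_norm hf
    have hf0 : 0 < ‖f‖ := norm_pos_iff.2 hf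
    have hu1 : ‖u‖ = 1 := by
      refine le_antisymm hu ?_
      have h := (le_abs_self _).trans (f.le_opNorm u)
      rw [hfu] at h
      exact (le_mul_iff_one_le_right hf0).1 h
    set c := ‖f‖ ^ (p - 1)⁻¹ with hc
    have hc0 : 0 < c := by positivity
    have hcp : c ^ (p - 1) = ‖f‖ := Real.rpow_inv_rpow hf0.le (by linarith)
    have hn : ‖c • u‖ = c := by rw [norm_smul, hu1, mul_one, Real.norm_of_nonneg hc0.le]
    refine ⟨c • u, ?_, by rw [hn, hcp]⟩
    rw [hn, map_smul, hfu, smul_eq_mul, ← rpow_sub_one_mul_self hp hc0.le, hcp, mul_comm]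

theorem tendsto_zero_of_descent {V d lam e : ℕ → ℝ} (hd : ∀ n, 0 ≤ d n) (hV : ∀ n, 0 ≤ V n)
    (hlam : ∀ n, 0 < lam n) (hlam0 : Tendsto lam atTop (𝓝 0))
    (hsum : Tendsto (fun N => ∑ n ∈ Finset.range N, lam n) atTop atTop)
    (he : Tendsto e atTop (𝓝 0)) (hstep : ∀ n, V (n + 1) ≤ V n - lam n * (d n - e n))
    (hsmall : ∀ ε, 0 < ε → ∃ δ, 0 < δ ∧ ∀ n, d n < δ → V n < ε) : Tendsto V atTop (𝓝 0) := by
  rw [Metric.tendsto_atTop]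
  intro ε hε
  obtain ⟨δ, hδ, hs⟩ := hsmall (ε / 2) (by linarith)
  obtain ⟨N, hN⟩ := eventually_atTop.1
    ((he.eventually (gt_mem_nhds (half_pos hδ))).and
      (hlam0.eventually (gt_mem_nhds (div_pos hε hδ))))
  have hbig : ∀ n, N ≤ n → δ ≤ d n → V (n + 1) ≤ V n - lam n * (δ / 2) := by
    intro n hn hdn
    have := mul_le_mul_of_nonneg_left (show δ / 2 ≤ d n - e n by linarith [(hN n hn).1])
      (hlam n).le
    linarith [hstep n]
  have hstart : ∃ n, N ≤ n ∧ V n < ε := by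
    by_contra! H
    have hdbig : ∀ n, N ≤ n → δ ≤ d n := by
      intro n hn
      by_contra! h
      linarith [hs n h, H n hn]
    have hdec : ∀ k, V (N + k) + δ / 2 * ∑ n ∈ Finset.range (N + k), lam n ≤
        V N + δ / 2 * ∑ n ∈ Finset.range N, lam n := by
      intro k
      induction k with
      | zero => simp
      | succ k ih =>
        rw [← Nat.add_assoc, Finset.sum_range_succ]
        have := hbig (N + k) (by omega) (hdbig _ (by omega))
        linarith
    obtain ⟨M, hM⟩ := eventually_atTop.1 ((hsum.const_mul_atTop (half_pos hδ)).eventually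
      (eventually_gt_atTop (V N + δ / 2 * ∑ n ∈ Finset.range N, lam n)))
    linarith [hM (N + M) (by omega), hdec M, hV (N + M)]
  obtain ⟨n₀, hn₀, hVn₀⟩ := hstart
  refine ⟨n₀, fun n hn => ?_⟩
  rw [Real.dist_eq, sub_zero, abs_of_nonneg (hV n)]
  induction n, hn using Nat.le_induction with
  | base => exact hVn₀
  | succ n hn ih =>
    rcases lt_or_ge (d n) δ with h | h
    · obtain ⟨h1, h2⟩ := hN n (hn₀.trans hn)
      have h3 := mul_le_mul_of_nonneg_left (show -(δ / 2) ≤ d n - e n by linarith [hd n])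
        (hlam n).le
      rw [lt_div_iff₀ hδ] at h2
      linarith [hstep n, hs n h]
    · have := mul_pos (hlam n) (half_pos hδ)
      linarith [hbig n (hn₀.trans hn) h]

theorem norm_le_of_lyapunov_le {p ρ : ℝ} (hp : 1 < p) (hρ : 0 ≤ ρ) {z x : E}
    (hz : p * ‖z‖ ≤ (p - 1) * ρ / 4) (h : lyapunov p z x ≤ 3 / 4 * ((p - 1) * ρ ^ p)) :
    ‖x‖ ≤ ρ + ‖z‖ := by
  by_contra! hlt
  have hp0 : 0 < p - 1 := by linarith
  have hxρ : ρ < ‖x‖ := by linarith [norm_nonneg z]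
  have hx0 : 0 < ‖x‖ := hρ.trans_lt hxρ
  have h1 := mul_le_mul_of_nonneg_left (dualityMap_apply_le hp x z) (show 0 ≤ p by linarith)
  have h2 : ρ ^ p < ‖x‖ ^ p := Real.rpow_lt_rpow hρ hxρ (by linarith)
  have h3 : p * (‖x‖ ^ (p - 1) * ‖z‖) ≤ (p - 1) / 4 * ‖x‖ ^ p := by
    rw [← rpow_sub_one_mul_self hp hx0.le]
    calc p * (‖x‖ ^ (p - 1) * ‖z‖) = ‖x‖ ^ (p - 1) * (p * ‖z‖) := by ring
      _ ≤ ‖x‖ ^ (p - 1) * ((p - 1) / 4 * ‖x‖) :=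
        mul_le_mul_of_nonneg_left (by nlinarith) (by positivity)
      _ = (p - 1) / 4 * (‖x‖ ^ (p - 1) * ‖x‖) := by ring
  have h4 := mul_lt_mul_of_pos_left h2 hp0
  have h5 : 0 ≤ ‖z‖ ^ p := by positivity
  unfold lyapunov at h
  linarith

theorem lyapunov_le_of_norm_le {p b : ℝ} (hp : 1 < p) (z : E) {x : E} (h : ‖x‖ ≤ b) :
    lyapunov p z x ≤ ‖z‖ ^ p + (p - 1) * b ^ p + p * (b ^ (p - 1) * ‖z‖) := by
  have h1 := mul_le_mul_of_nonneg_left (neg_dualityMap_apply_le hp x z)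
    (show 0 ≤ p by linarith)
  have h2 : p * (‖x‖ ^ (p - 1) * ‖z‖) ≤ p * (b ^ (p - 1) * ‖z‖) := by gcongr
  have h3 : (p - 1) * ‖x‖ ^ p ≤ (p - 1) * b ^ p := by gcongr
  unfold lyapunov
  linarith

theorem eventually_radius_large {p η a : ℝ} (hp : 1 < p) (hη : 0 < η) (ha : 0 ≤ a) (C W : ℝ) :
    ∀ᶠ ρ : ℝ in atTop, p * a ≤ (p - 1) * ρ / 4 ∧
      a ^ p + (p - 1) * ((1 / 2) ^ (1 / p) * ρ + a + 1) ^ p +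
        p * (((1 / 2) ^ (1 / p) * ρ + a + 1) ^ (p - 1) * a) ≤ 3 / 4 * ((p - 1) * ρ ^ p) ∧
      C * (ρ + 2 * a) ≤ η * ρ ^ p / 4 ∧ W ≤ 3 / 4 * ((p - 1) * ρ ^ p) := by
  have hp0 : 0 < p := by linarith
  have hp1 : 0 < p - 1 := by linarith
  set c : ℝ := (1 / 2) ^ (1 / p) with hc
  set c' : ℝ := (5 / 8) ^ (1 / p) with hc'
  have hc0 : 0 ≤ c := by positivity
  have hcc : c < c' := Real.rpow_lt_rpow (by norm_num) (by norm_num) (by positivity)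
  have hc'1 : c' ≤ 1 := Real.rpow_le_one (by norm_num) (by norm_num) (by positivity)
  have hc'p : c' ^ p = 5 / 8 := by
    rw [hc', one_div, Real.rpow_inv_rpow (by norm_num) hp0.ne']
  have t1 : Tendsto (fun ρ : ℝ => ρ ^ p) atTop atTop := tendsto_rpow_atTop hp0
  have t2 : Tendsto (fun ρ : ℝ => ρ ^ (p - 1)) atTop atTop := tendsto_rpow_atTop hp1
  filter_upwards [eventually_ge_atTop (16 * (p * a) / (p - 1)),
    eventually_ge_atTop ((a + 1) / (c' - c)), eventually_gt_atTop 0, eventually_ge_atTop (2 * a),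
    t1.eventually_ge_atTop (16 * a ^ p / (p - 1)), t2.eventually_ge_atTop (8 * |C| / η),
    t1.eventually_ge_atTop (4 / 3 * W / (p - 1))] with ρ h1 h2 h3 h4 h5 h6 h7
  rw [div_le_iff₀ hp1] at h1 h5 h7
  rw [div_le_iff₀ (sub_pos.2 hcc)] at h2
  rw [div_le_iff₀ hη] at h6
  have hb : c * ρ + a + 1 ≤ c' * ρ := by linarith
  have hb0 : 0 ≤ c * ρ + a + 1 := by positivity
  have hbp : (c * ρ + a + 1) ^ p ≤ 5 / 8 * ρ ^ p := by
    rw [← hc'p, ← Real.mul_rpow (hc0.trans hcc.le) h3.le]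
    exact Real.rpow_le_rpow hb0 hb hp0.le
  have hbp1 : (c * ρ + a + 1) ^ (p - 1) ≤ ρ ^ (p - 1) :=
    Real.rpow_le_rpow hb0 (hb.trans (mul_le_of_le_one_left h3.le hc'1)) hp1.le
  have e := rpow_sub_one_mul_self hp h3.le
  refine ⟨by nlinarith, ?_, ?_, by linarith⟩
  · have k1 := mul_le_mul_of_nonneg_left hbp hp1.le
    have k2 : p * ((c * ρ + a + 1) ^ (p - 1) * a) ≤ (p - 1) / 16 * ρ ^ p := by
      rw [← e]
      calc p * ((c * ρ + a + 1) ^ (p - 1) * a) ≤ p * (ρ ^ (p - 1) * a) := by gcongr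
        _ = ρ ^ (p - 1) * (p * a) := by ring
        _ ≤ ρ ^ (p - 1) * ((p - 1) / 16 * ρ) :=
          mul_le_mul_of_nonneg_left (by linarith) (by positivity)
        _ = (p - 1) / 16 * (ρ ^ (p - 1) * ρ) := by ring
    linarith
  · calc C * (ρ + 2 * a) ≤ |C| * (ρ + ρ) := by
          gcongr
          exact le_abs_self C
      _ = 8 * |C| * ρ / 4 := by ring
      _ ≤ ρ ^ (p - 1) * η * ρ / 4 := by gcongr
      _ = η * ρ ^ p / 4 := by rw [← e]; ring

theorem dualityInv_dualityMap [UniformConvexSpace E] {p : ℝ} (hp : 1 < p) (x : E) :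
    dualityInv p (dualityMap p x) = x :=
  Function.leftInverse_invFun (dualityMap_injective hp) x

theorem dualityMap_dualityInv [CompleteSpace E] [UniformConvexSpace E] (hE : IsUniformlySmooth E)
    {p : ℝ} (hp : 1 < p) (f : StrongDual ℝ E) : dualityMap p (dualityInv p f) = f :=
  Function.rightInverse_invFun (dualityMap_surjective hE hp) f

theorem norm_dualityInv_le [CompleteSpace E] [UniformConvexSpace E] (hE : IsUniformlySmooth E)
    {p ρ : ℝ} (hp : 1 < p) {f : StrongDual ℝ E} (hf : ‖f‖ ≤ ρ) :
    ‖dualityInv p f‖ ≤ ρ ^ (p - 1)⁻¹ := by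
  have hp1 : 0 < p - 1 := by linarith
  rw [← Real.rpow_rpow_inv (norm_nonneg (dualityInv p f)) hp1.ne', ← norm_dualityMap hp,
    dualityMap_dualityInv hE hp]
  exact Real.rpow_le_rpow (norm_nonneg _) hf (by positivity)

theorem norm_sub_le_dualityInvModulus [CompleteSpace E] [UniformConvexSpace E]
    (hE : IsUniformlySmooth E) {p ρ t : ℝ} (hp : 1 < p) {f g : StrongDual ℝ E} (hf : ‖f‖ ≤ ρ)
    (hg : ‖g‖ ≤ ρ) (hfg : ‖f - g‖ ≤ t) :
    ‖dualityInv p f - dualityInv p g‖ ≤ dualityInvModulus E p ρ t := by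
  refine le_csSup ⟨ρ ^ (p - 1)⁻¹ + ρ ^ (p - 1)⁻¹, ?_⟩ ⟨f, g, hf, hg, hfg, rfl⟩
  rintro s ⟨f', g', hf', hg', -, rfl⟩
  exact (norm_sub_le _ _).trans
    (add_le_add (norm_dualityInv_le hE hp hf') (norm_dualityInv_le hE hp hg'))

theorem one_le_stepBound (p : ℝ) (A : E → StrongDual ℝ E) (x₁ : E) (B : ℝ) :
    1 ≤ stepBound p A x₁ B := by
  have : 0 ≤ stepBound p A x₁ B - 1 := by
    rw [stepBound, add_sub_cancel_right]
    refine Real.sSup_nonneg ?_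
    rintro s ⟨_, _, _, _, _, rfl⟩
    exact norm_nonneg _
  linarith

theorem norm_le_stepBound {p : ℝ} (hp : 1 < p) {A : E → StrongDual ℝ E} (hA : IsBoundedMap A)
    (x₁ : E) {B θ : ℝ} (hθ : θ ∈ Ioo (0 : ℝ) 1) {x : E} (hx : ‖x‖ ≤ B) :
    ‖A x + θ • (dualityMap p x - dualityMap p x₁)‖ ≤ stepBound p A x₁ B := by
  obtain ⟨K, hK⟩ := (hA _ (Metric.isBounded_closedBall (x := (0 : E)) (r := B))).exists_norm_le
  refine le_add_of_le_of_nonneg (le_csSup ⟨K + (B ^ (p - 1) + ‖x₁‖ ^ (p - 1)), ?_⟩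
    ⟨θ, x, hθ.1, hθ.2, hx, rfl⟩) zero_le_one
  rintro s ⟨t, y, ht0, ht1, hy, rfl⟩
  refine (norm_add_le _ _).trans (add_le_add (hK _ ⟨y, by simpa using hy, rfl⟩) ?_)
  rw [norm_smul, Real.norm_of_nonneg ht0.le]
  refine (mul_le_of_le_one_left (norm_nonneg _) ht1.le).trans ((norm_sub_le _ _).trans ?_)
  rw [norm_dualityMap hp, norm_dualityMap hp]
  gcongr

theorem lyapunov_step_le [CompleteSpace E] [UniformConvexSpace E] (hE : IsUniformlySmooth E)
    {p η M l θ : ℝ} (hp : 1 < p) {A : E → StrongDual ℝ E} (hA : IsStronglyMonotone p η A)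
    {z x₁ x x' : E} (hz : A z = 0) (hl : 0 ≤ l) (hθ : 0 ≤ θ)
    (hM : ‖A x + θ • (dualityMap p x - dualityMap p x₁)‖ ≤ M)
    (hx' : x' = dualityInv p (dualityMap p x -
      l • (A x + θ • (dualityMap p x - dualityMap p x₁)))) :
    lyapunov p z x' ≤ lyapunov p z x - p * l * (η * ‖x - z‖ ^ p -
      (θ * (‖dualityMap p z - dualityMap p x₁‖ * ‖x - z‖) + M * ‖x' - x‖)) := by
  set w := A x + θ • (dualityMap p x - dualityMap p x₁) with hw
  have hJ : dualityMap p x' - dualityMap p x = -(l • w) := by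
    rw [hx', dualityMap_dualityInv hE hp]; abel
  have h1 := lyapunov_add hp z x x'
  have h2 := lyapunov_nonneg hp x' x
  rw [hJ, neg_apply, smul_apply, smul_eq_mul] at h1
  have h3 : w (x' - z) = w (x - z) + w (x' - x) := by
    rw [← map_add]; congr 1; abel
  have h4 : -(M * ‖x' - x‖) ≤ w (x' - x) := by
    have h := (neg_le_abs _).trans ((w.le_opNorm (x' - x)).trans
      (mul_le_mul_of_nonneg_right hM (norm_nonneg _)))
    linarith
  have h5 := hA.2 x z
  rw [hz, sub_zero] at h5
  have h6 := dualityMap_monotone hp z x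
  have h7 : -(‖dualityMap p z - dualityMap p x₁‖ * ‖x - z‖) ≤
      (dualityMap p x - dualityMap p x₁) (x - z) := by
    have h := (neg_le_abs _).trans ((dualityMap p z - dualityMap p x₁).le_opNorm (x - z))
    simp only [sub_apply] at h h6 ⊢
    linarith
  have h8 : w (x - z) = A x (x - z) + θ * (dualityMap p x - dualityMap p x₁) (x - z) := by
    simp only [hw, add_apply, smul_apply, smul_eq_mul]
  have h9 := mul_le_mul_of_nonneg_left h7 hθ
  have h10 : p * l * (η * ‖x - z‖ ^ p -
      (θ * (‖dualityMap p z - dualityMap p x₁‖ * ‖x - z‖) + M * ‖x' - x‖)) ≤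
      p * l * w (x' - z) :=
    mul_le_mul_of_nonneg_left (by linarith) (mul_nonneg (by linarith) hl)
  linarith

theorem norm_iteration_step_le [CompleteSpace E] [UniformConvexSpace E]
    (hE : IsUniformlySmooth E) {p B M l : ℝ} (hp : 1 < p) (hl : l ∈ Ioo (0 : ℝ) 1) {x : E}
    (hx : ‖x‖ ≤ B) {w : StrongDual ℝ E} (hw : ‖w‖ ≤ M) :
    ‖dualityInv p (dualityMap p x - l • w) - x‖ ≤
      dualityInvModulus E p (B ^ (p - 1) + M) (l * M) := by
  have hlw : ‖l • w‖ ≤ l * M := by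
    rw [norm_smul, Real.norm_of_nonneg hl.1.le]
    exact mul_le_mul_of_nonneg_left hw hl.1.le
  have hM : 0 ≤ M := (norm_nonneg w).trans hw
  have hJ : ‖dualityMap p x‖ ≤ B ^ (p - 1) := by
    rw [norm_dualityMap hp]
    gcongr
  nth_rewrite 2 [← dualityInv_dualityMap hp x]
  refine norm_sub_le_dualityInvModulus hE hp ?_ (by linarith) (by simpa using hlw)
  exact (norm_sub_le _ _).trans
    (add_le_add hJ (hlw.trans (mul_le_of_le_one_left hM hl.2.le)))

/-- One step keeps the iterate in a sublevel set of the Lyapunov functional. -/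
theorem lyapunov_step_le_of_le [CompleteSpace E] [UniformConvexSpace E]
    (hE : IsUniformlySmooth E) {p η M l θ ρ : ℝ} (hp : 1 < p) {A : E → StrongDual ℝ E}
    (hA : IsStronglyMonotone p η A) {z x₁ x x' : E} (hz : A z = 0) (hl : 0 ≤ l)
    (hθ : θ ∈ Ioo (0 : ℝ) 1) (hM0 : 0 < M) (hρ : 0 ≤ ρ)
    (hM : ‖A x + θ • (dualityMap p x - dualityMap p x₁)‖ ≤ M)
    (hx' : x' = dualityInv p (dualityMap p x -
      l • (A x + θ • (dualityMap p x - dualityMap p x₁))))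
    (hstep : ‖x' - x‖ ≤ min 1 (η * ρ ^ p / (4 * M)))
    (h₁ : ‖z‖ ^ p + (p - 1) * ((1 / 2) ^ (1 / p) * ρ + ‖z‖ + 1) ^ p +
        p * (((1 / 2) ^ (1 / p) * ρ + ‖z‖ + 1) ^ (p - 1) * ‖z‖) ≤ 3 / 4 * ((p - 1) * ρ ^ p))
    (h₂ : ‖dualityMap p z - dualityMap p x₁‖ * (ρ + 2 * ‖z‖) ≤ η * ρ ^ p / 4)
    (hxρ : ‖x‖ ≤ ρ + ‖z‖) (hx : lyapunov p z x ≤ 3 / 4 * ((p - 1) * ρ ^ p)) :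
    lyapunov p z x' ≤ 3 / 4 * ((p - 1) * ρ ^ p) := by
  have hp0 : 0 < p := by linarith
  rcases lt_or_ge ‖x - z‖ ((1 / 2) ^ (1 / p) * ρ) with hd | hd
  · refine (lyapunov_le_of_norm_le hp z ?_).trans h₁
    have e : x' = (x - z) + z + (x' - x) := by abel
    rw [e]
    refine (norm_add₃_le).trans ?_
    linarith [hstep.trans (min_le_left _ _)]
  · have hdp : η * (ρ ^ p / 2) ≤ η * ‖x - z‖ ^ p := by
      have h := Real.rpow_le_rpow (by positivity) hd hp0.le
      rw [Real.mul_rpow (by positivity) hρ, one_div p,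
        Real.rpow_inv_rpow (by norm_num) hp0.ne'] at h
      exact mul_le_mul_of_nonneg_left (by linarith) hA.1.le
    have hC : θ * (‖dualityMap p z - dualityMap p x₁‖ * ‖x - z‖) ≤ η * ρ ^ p / 4 := by
      refine (mul_le_of_le_one_left (by positivity) hθ.2.le).trans (le_trans ?_ h₂)
      refine mul_le_mul_of_nonneg_left ?_ (norm_nonneg _)
      linarith [norm_sub_le x z]
    have hMs : M * ‖x' - x‖ ≤ η * ρ ^ p / 4 := by
      have h := hstep.trans (min_le_right _ _)
      rw [le_div_iff₀ (by positivity)] at h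
      linarith
    have h := lyapunov_step_le hE hp hA hz hl hθ.1.le hM hx'
    have h' : 0 ≤ p * l * (η * ‖x - z‖ ^ p -
        (θ * (‖dualityMap p z - dualityMap p x₁‖ * ‖x - z‖) + M * ‖x' - x‖)) :=
      mul_nonneg (mul_nonneg hp0.le hl) (by linarith)
    linarith

/-- The inverse duality mapping is uniformly continuous on bounded sets. -/
theorem tendsto_norm_sub_of_tendsto_dualityMap [UniformConvexSpace E] {p R : ℝ} (hp : 1 < p)
    {x y : ℕ → E} (hx : ∀ n, ‖x n‖ ≤ R) (hy : ∀ n, ‖y n‖ ≤ R)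
    (h : Tendsto (fun n => ‖dualityMap p (y n) - dualityMap p (x n)‖) atTop (𝓝 0)) :
    Tendsto (fun n => ‖y n - x n‖) atTop (𝓝 0) := by
  rw [Metric.tendsto_atTop]
  intro ε hε
  obtain ⟨δ, hδ, hc⟩ := exists_forall_lyapunov_lt (E := E) hp R hε
  have h' := h.const_mul (p * (2 * R))
  rw [mul_zero] at h'
  obtain ⟨N, hN⟩ := eventually_atTop.1 (h'.eventually (gt_mem_nhds hδ))
  refine ⟨N, fun n hn => ?_⟩
  rw [Real.dist_eq, sub_zero, abs_norm]
  refine hc _ _ (hy n) (hx n) (lt_of_le_of_lt ?_ (hN n hn))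
  have h1 := lyapunov_add hp (x n) (x n) (y n)
  rw [lyapunov_self hp] at h1
  have h2 := (le_abs_self _).trans
    ((dualityMap p (y n) - dualityMap p (x n)).le_opNorm (y n - x n))
  have h3 : ‖y n - x n‖ ≤ 2 * R := (norm_sub_le _ _).trans (by linarith [hx n, hy n])
  have h4 := mul_le_mul_of_nonneg_left
    (h2.trans (mul_le_mul_of_nonneg_left h3 (norm_nonneg _))) (show 0 ≤ p by linarith)
  linarith [lyapunov_nonneg hp (y n) (x n)]

theorem exists_forall_lyapunov_lt_of_norm_sub_lt {p : ℝ} (hp : 1 < p) (z : E) {ε : ℝ}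
    (hε : 0 < ε) : ∃ δ, 0 < δ ∧ ∀ x : E, ‖x - z‖ < δ → lyapunov p z x < ε := by
  have hc : Continuous fun x : E => ‖z‖ ^ p - ‖x‖ ^ p + p * (‖x‖ ^ (p - 1) * ‖x - z‖) := by
    have h1 : Continuous fun x : E => ‖x‖ ^ p :=
      continuous_norm.rpow_const fun _ => .inr (by linarith)
    have h2 : Continuous fun x : E => ‖x‖ ^ (p - 1) :=
      continuous_norm.rpow_const fun _ => .inr (by linarith)
    fun_prop
  have h0 := hc.tendsto z
  simp only [sub_self, norm_zero, mul_zero, add_zero] at h0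
  obtain ⟨δ, hδ, h⟩ := Metric.eventually_nhds_iff.1 (h0.eventually (gt_mem_nhds hε))
  exact ⟨δ, hδ, fun x hx => (lyapunov_le hp z x).trans_lt (h (by rwa [dist_eq_norm]))⟩

theorem tendsto_of_tendsto_lyapunov [UniformConvexSpace E] {p R : ℝ} (hp : 1 < p) {z : E}
    (hz : ‖z‖ ≤ R) {x : ℕ → E} (hx : ∀ n, ‖x n‖ ≤ R)
    (h : Tendsto (fun n => lyapunov p z (x n)) atTop (𝓝 0)) : Tendsto x atTop (𝓝 z) := by
  rw [Metric.tendsto_atTop]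
  intro ε hε
  obtain ⟨δ, hδ, hc⟩ := exists_forall_lyapunov_lt (E := E) hp R hε
  obtain ⟨N, hN⟩ := eventually_atTop.1 (h.eventually (gt_mem_nhds hδ))
  exact ⟨N, fun n hn => by
    rw [dist_eq_norm]
    exact hc _ _ (hx n) hz (hN n hn)⟩

theorem AdmissibleSteps.tendsto_lam {lam θ : ℕ → ℝ} (h : AdmissibleSteps lam θ) :
    Tendsto (fun n => lam (n + 1)) atTop (𝓝 0) := by
  have h1 := h.sum_lam_sq.tendsto_atTop_zero.sqrt
  rw [Real.sqrt_zero] at h1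
  refine h1.congr fun n => Real.sqrt_sq (h.lam_mem (n + 1) (by omega)).1.le

theorem AdmissibleSteps.tendsto_sum_lam {lam θ : ℕ → ℝ} (h : AdmissibleSteps lam θ) :
    Tendsto (fun N => ∑ n ∈ Finset.range N, lam (n + 1)) atTop atTop := by
  refine tendsto_atTop_mono (fun N => ?_) h.sum_lam_theta
  rw [Finset.range_eq_Ico, Finset.sum_Ico_add' lam 0 N 1, zero_add]
  have e : Finset.Icc 1 N = Finset.Ico 1 (N + 1) := by
    ext n
    simp only [Finset.mem_Icc, Finset.mem_Ico]
    omega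
  rw [e]
  refine Finset.sum_le_sum fun n hn => ?_
  have hn1 := (Finset.mem_Ico.1 hn).1
  exact mul_le_of_le_one_right (h.lam_mem n hn1).1.le (h.theta_mem n hn1).2.le

theorem tendsto_of_isIteration [CompleteSpace E] [UniformConvexSpace E]
    (hE : IsUniformlySmooth E) {p η M B : ℝ} (hp : 1 < p) {A : E → StrongDual ℝ E}
    (hA : IsStronglyMonotone p η A) {z x₁ : E} (hz : A z = 0) {lam θ : ℕ → ℝ}
    (hs : AdmissibleSteps lam θ) {x : ℕ → E} (hx : IsIteration p A lam θ x₁ x) (hzB : ‖z‖ ≤ B)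
    (hB : ∀ n, ‖x (n + 1)‖ ≤ B)
    (hM : ∀ n, ‖A (x (n + 1)) +
      θ (n + 1) • (dualityMap p (x (n + 1)) - dualityMap p x₁)‖ ≤ M) :
    Tendsto x atTop (𝓝 z) := by
  have hp0 : 0 < p := by linarith
  have hl : ∀ n, 0 < lam (n + 1) := fun n => (hs.lam_mem (n + 1) (by omega)).1
  have hθ : ∀ n, 0 < θ (n + 1) := fun n => (hs.theta_mem (n + 1) (by omega)).1
  have hgap : Tendsto (fun n => ‖x (n + 2) - x (n + 1)‖) atTop (𝓝 0) := by
    refine tendsto_norm_sub_of_tendsto_dualityMap hp hB (fun n => hB (n + 1)) ?_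
    have hb : Tendsto (fun n => lam (n + 1) * M) atTop (𝓝 0) := by
      simpa using hs.tendsto_lam.mul_const M
    refine squeeze_zero (fun n => norm_nonneg _) (fun n => ?_) hb
    rw [hx.2 (n + 1) (by omega), dualityMap_dualityInv hE hp, sub_sub_cancel_left, norm_neg,
      norm_smul, Real.norm_of_nonneg (hl n).le]
    exact mul_le_mul_of_nonneg_left (hM n) (hl n).le
  set C := ‖dualityMap p z - dualityMap p x₁‖
  set e : ℕ → ℝ := fun n => p * (θ (n + 1) * (C * (2 * B)) + M * ‖x (n + 2) - x (n + 1)‖)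
  have he : Tendsto e atTop (𝓝 0) := by
    have h1 := (((tendsto_add_atTop_iff_nat 1).2 hs.theta_lim).mul_const (C * (2 * B))).add
      (hgap.const_mul M)
    simpa using h1.const_mul p
  rw [← tendsto_add_atTop_iff_nat 1]
  refine tendsto_of_tendsto_lyapunov hp hzB hB ?_
  refine tendsto_zero_of_descent (d := fun n => p * (η * ‖x (n + 1) - z‖ ^ p)) (e := e)
    (fun n => mul_nonneg hp0.le (mul_nonneg hA.1.le (by positivity)))
    (fun n => lyapunov_nonneg hp _ _) hl hs.tendsto_lam hs.tendsto_sum_lam he (fun n => ?_)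
    fun ε hε => ?_
  · refine (lyapunov_step_le hE hp hA hz (hl n).le (hθ n).le (hM n)
      (hx.2 (n + 1) (by omega))).trans ?_
    have h1 : ‖x (n + 1) - z‖ ≤ 2 * B := (norm_sub_le _ _).trans (by linarith [hB n])
    have h2 : θ (n + 1) * (C * ‖x (n + 1) - z‖) ≤ θ (n + 1) * (C * (2 * B)) :=
      mul_le_mul_of_nonneg_left (mul_le_mul_of_nonneg_left h1 (norm_nonneg _)) (hθ n).le
    have h3 := mul_le_mul_of_nonneg_left h2 (mul_nonneg hp0.le (hl n).le)
    simp only [e]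
    linarith
  · obtain ⟨δ, hδ, h⟩ := exists_forall_lyapunov_lt_of_norm_sub_lt hp z hε
    refine ⟨p * (η * δ ^ p), mul_pos hp0 (mul_pos hA.1 (by positivity)), fun n hn => h _ ?_⟩
    exact (Real.rpow_lt_rpow_iff (norm_nonneg _) hδ.le hp0).1
      (lt_of_mul_lt_mul_left (lt_of_mul_lt_mul_left hn hp0.le) hA.1.le)

end

theorem mainTheorem1 {E : Type*} [NormedAddCommGroup E] [NormedSpace ℝ E] [CompleteSpace E]
    [UniformConvexSpace E] (hE : IsUniformlySmooth E)
    (p : ℝ) (hp : 1 < p) (η : ℝ) (A : E → StrongDual ℝ E)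
    (hbdd : IsBoundedMap A) (hmono : IsStronglyMonotone p η A) (hrange : RangeCondition p A)
    (z : E) (hz : A z = 0) (x₁ : E) :
    (∀ x : E, dualitySet p x = {dualityMap p x}) ∧
    Function.Bijective (dualityMap (E := E) p) ∧
    (∀ w : E, A w = 0 → w = z) ∧
    ∃ r₀ : ℝ, 0 < r₀ ∧ ∀ r B M₀ ε₀ : ℝ, r₀ ≤ r → B = r ^ (1 / p) + ‖z‖ →
      M₀ = stepBound p A x₁ B → ε₀ = min 1 (η * r / (4 * M₀)) →
      ∀ lam θ : ℕ → ℝ, AdmissibleSteps lam θ →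
        (∀ n, 1 ≤ n → dualityInvModulus E p (B ^ (p - 1) + M₀) (lam n * M₀) ≤ ε₀) →
        ∀ x : ℕ → E, IsIteration p A lam θ x₁ x → Tendsto x atTop (𝓝 z) := by
  have hp0 : 0 < p := by linarith
  refine ⟨fun x => (hE.dualitySet_subsingleton hp x).eq_singleton_of_mem (dualityMap_mem hp x),
    ⟨dualityMap_injective hp, dualityMap_surjective hE hp⟩, fun w hw => ?_, ?_⟩
  · by_contra hne
    have h := hmono.2 w z
    rw [hw, hz, sub_zero, zero_apply] at h
    have h0 : 0 < ‖w - z‖ := norm_pos_iff.2 (sub_ne_zero.2 hne)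
    have := mul_pos hmono.1 (Real.rpow_pos_of_pos h0 p)
    linarith
  · obtain ⟨ρ₀, hρ₀⟩ := eventually_atTop.1 (eventually_radius_large hp hmono.1 (norm_nonneg z)
      ‖dualityMap p z - dualityMap p x₁‖ (lyapunov p z x₁))
    refine ⟨max ρ₀ 1 ^ p, by positivity, ?_⟩
    rintro r B M₀ ε₀ hr rfl hM₀ rfl lam θ hs hψ x hx
    have hr0 : 0 ≤ r := le_trans (by positivity) hr
    set ρ := r ^ (1 / p) with hρ
    have hρ0 : 0 ≤ ρ := by positivity
    have hρp : ρ ^ p = r := by rw [hρ, one_div, Real.rpow_inv_rpow hr0 hp0.ne']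
    have hρρ : ρ₀ ≤ ρ := by
      refine (le_max_left ρ₀ 1).trans ?_
      rwa [← Real.rpow_le_rpow_iff (by positivity) hρ0 hp0, hρp]
    obtain ⟨h1, h2, h3, h4⟩ := hρ₀ ρ hρρ
    have hM1 : 0 < M₀ := by
      rw [hM₀]
      exact zero_lt_one.trans_le (one_le_stepBound p A x₁ _)
    have hw : ∀ n, 1 ≤ n → ‖x n‖ ≤ ρ + ‖z‖ →
        ‖A (x n) + θ n • (dualityMap p (x n) - dualityMap p x₁)‖ ≤ M₀ := fun n hn hxn => by
      rw [hM₀]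
      exact norm_le_stepBound hp hbdd x₁ (hs.theta_mem n hn) hxn
    have hbound : ∀ n, 1 ≤ n → lyapunov p z (x n) ≤ 3 / 4 * ((p - 1) * ρ ^ p) := by
      intro n hn
      induction n, hn using Nat.le_induction with
      | base => rwa [hx.1]
      | succ n hn ih =>
        have hxn := norm_le_of_lyapunov_le hp hρ0 h1 ih
        refine lyapunov_step_le_of_le hE hp hmono hz (hs.lam_mem n hn).1.le (hs.theta_mem n hn)
          hM1 hρ0 (hw n hn hxn) (hx.2 n hn) ?_ h2 h3 hxn ih
        rw [hx.2 n hn, hρp]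
        exact (norm_iteration_step_le hE hp (hs.lam_mem n hn) hxn (hw n hn hxn)).trans (hψ n hn)
    have hB : ∀ n, 1 ≤ n → ‖x n‖ ≤ ρ + ‖z‖ := fun n hn =>
      norm_le_of_lyapunov_le hp hρ0 h1 (hbound n hn)
    exact tendsto_of_isIteration hE hp hmono hz hs hx (le_add_of_nonneg_left hρ0)
      (fun n => hB (n + 1) (by omega)) fun n => hw (n + 1) (by omega) (hB (n + 1) (by omega))

end
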